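/- Let $d\ge 0$ and let $\Omega=\{\omega\in C(\mathbb R_+,\mathbb R^d):\omega(0)=0\}$ carry the topology of uniform convergence on compact intervals and its Borel $\sigma$-algebra $\mathcal B(\Omega)$; let $B$ be the canonical process, $\mathcal F_t=\sigma(B_s,\,s\le t)$, $\mathcal F_t^+=\bigcap_{s>t}\mathcal F_s$ and $\mathcal F_\infty=\sigma(B_s,\,s\ge 0)$. For a probability measure $\mathbb P$ on $(\Omega,\mathcal B(\Omega))$ and a $\sigma$-algebra $\mathcal G\subset\mathcal B(\Omega)$ let $\mathcal N^{\mathbb P}(\mathcal G)$ be the class of all sets $D\subset\Omega$ contained in some $\widetilde D\in\mathcal G$ with $\mathbb P(\widetilde D)=0$. Let $\mathcal P$ be a set of probability measures on $(\Omega,\mathcal B(\Omega))$ (for instance the weakly compact set that represents the $G$-expectation). Put $\mathcal N_{\mathcal P}=\bigcap_{\mathbb P\in\mathcal P}\mathcal N^{\mathbb P}(\mathcal F_\infty)$ and let $\mathbb F^{\mathcal P}=(\widehat{\mathcal F}^{\mathcal P}_t)_{t\ge0}$ be the universal filtration $$\widehat{\mathcal F}^{\mathcal P}_t=\bigcap_{\mathbb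 P\in\mathcal P}\bigl(\mathcal F_t^{\mathbb P}\vee\mathcal N_{\mathcal P}\bigr),\qquad \mathcal F_t^{\mathbb P}=\mathcal F_t^+\vee\mathcal N^{\mathbb P}(\mathcal F_t^+).$$ A property holds quasi-surely if it holds outside a set $A\in\mathcal B(\Omega)$ with $\mathbb P(A)=0$ for all $\mathbb P\in\mathcal P$; in particular it then holds $\mathbb P$-almost surely for every $\mathbb P\in\mathcal P$. Let $T\ge 0$, let $U$ be a compact (hence separable) metric space, and let $(\mu_t)_{t\in[0,T]}$ be an $\mathbb F^{\mathcal P}$-progressively measurable process with values in the set $\mathcal P(U)$ of Borel probability measures on $U$; that is, for each Borel set $A\subset U$ and each $t\in[0,T]$ the map $(s,\omega)\mapsto\mu_s(\omega,A)$ on $[0,t]\times\Omega$ is $\mathcal B([0,t])\otimes\widehat{\mathcal F}^{\mathcal P}_t$-measurable. Then there is a sequence $(u_n)_{n\ge0}$ of $\mathbb F^{\mathcal P}$-progressively measurable processes $(u_n(t))_{t\in[0,T]}$ with values in $U$ such that, quasi-surely, the measures $\delta_{u_n(t)}(da)\,dt$ on $[0,T]\times U$ converge to $\mu_t(da)\,dt$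 in the topology of stable convergence, and hence also weakly. Here the topology of stable convergence, on the measures on $[0,T]\times U$ whose projection on $[0,T]$ is Lebesgue measure, is the coarsest topology for which $q\mapsto\int\varphi\,dq$ is continuous for every bounded measurable $\varphi:[0,T]\times U\to\mathbb R$ such that $\varphi(t,\cdot)$ is continuous for every $t$. -/

import Mathlib

open MeasureTheory ProbabilityTheory Filter Topology
open scoped NNReal ENNReal

noncomputable section

/-- The path space `Ω` of continuous `ω : ℝ₊ → ℝ^d` with `ω 0 = 0`. -/
def PathSpace (d : ℕ) : Type :=
  {ω : C(ℝ≥0, EuclideanSpace ℝ (Fin d)) // ω 0 = 0}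

namespace PathSpace

variable {d : ℕ}

/-- The topology of uniform convergence on compact time intervals (on `C(ℝ≥0, ℝ^d)` this is
Mathlib's compact-open topology). -/
instance : TopologicalSpace (PathSpace d) :=
  inferInstanceAs
    (TopologicalSpace {ω : C(ℝ≥0, EuclideanSpace ℝ (Fin d)) // ω 0 = 0})

instance : MeasurableSpace (PathSpace d) := borel _

instance : BorelSpace (PathSpace d) := ⟨rfl⟩

/-- The canonical process `B`. -/
def canonical (t : ℝ≥0) (ω : PathSpace d) : EuclideanSpace ℝ (Fin d) := ω.1 t

/-- The raw filtration `ℱ_t = σ(B_s, s ≤ t)`. -/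
@[reducible] def rawSigma (t : ℝ≥0) : MeasurableSpace (PathSpace d) :=
  ⨆ s : Set.Iic t, MeasurableSpace.comap (canonical s.1) inferInstance

/-- `ℱ_∞ = σ(B_s, s ≥ 0)`. -/
@[reducible] def sigmaInfty : MeasurableSpace (PathSpace d) :=
  ⨆ s : ℝ≥0, MeasurableSpace.comap (canonical s) inferInstance

/-- The right limit `ℱ_t⁺ = ⋂_{s > t} ℱ_s`. -/
@[reducible] def sigmaPlus (t : ℝ≥0) : MeasurableSpace (PathSpace d) :=
  ⨅ s : Set.Ioi t, rawSigma s.1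

/-- The class `𝒩^P(𝒢)` of `P`-negligible sets of a σ-algebra `𝒢`: all sets (measurable or not)
covered by a `P`-null set of `𝒢`. -/
def negligible (P : ProbabilityMeasure (PathSpace d)) (G : MeasurableSpace (PathSpace d)) :
    Set (Set (PathSpace d)) :=
  {D | ∃ D' : Set (PathSpace d),
    MeasurableSet[G] D' ∧ D ⊆ D' ∧ P.1 D' = 0}

/-- `𝒩_𝔓 = ⋂_{P ∈ 𝔓} 𝒩^P(ℱ_∞)`. -/
def polarSets (𝔓 : Set (ProbabilityMeasure (PathSpace d))) : Set (Set (PathSpace d)) :=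
  ⋂ P ∈ 𝔓, negligible P sigmaInfty

/-- `ℱ_t^P = ℱ_t⁺ ∨ 𝒩^P(ℱ_t⁺)`. -/
@[reducible] def sigmaCompleted (P : ProbabilityMeasure (PathSpace d)) (t : ℝ≥0) :
    MeasurableSpace (PathSpace d) :=
  sigmaPlus t ⊔ MeasurableSpace.generateFrom (negligible P (sigmaPlus t))

/-- The universal σ-algebra `⋂_{P ∈ 𝔓} (ℱ_t^P ∨ 𝒩_𝔓)`. -/
@[reducible] def universalSigma (𝔓 : Set (ProbabilityMeasure (PathSpace d))) (t : ℝ≥0) :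
    MeasurableSpace (PathSpace d) :=
  ⨅ P ∈ 𝔓, sigmaCompleted P t ⊔ MeasurableSpace.generateFrom (polarSets 𝔓)

theorem rawSigma_mono : Monotone (rawSigma (d := d)) := fun _ t hst =>
  iSup_le fun r => le_iSup
    (fun r : Set.Iic t => MeasurableSpace.comap (canonical (d := d) r.1) inferInstance)
    ⟨r.1, le_trans r.2 hst⟩

theorem sigmaPlus_mono : Monotone (sigmaPlus (d := d)) := fun s _ hst =>
  le_iInf fun r => iInf_le (fun r : Set.Ioi s => rawSigma (d := d) r.1)
    ⟨r.1, lt_of_le_of_lt hst r.2⟩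

theorem sigmaCompleted_mono (P : ProbabilityMeasure (PathSpace d)) :
    Monotone (sigmaCompleted P) := fun s t hst =>
  sup_le_sup (sigmaPlus_mono hst) (MeasurableSpace.generateFrom_mono (by
    rintro D ⟨D', hD', hsub, h0⟩
    exact ⟨D', sigmaPlus_mono hst D' hD', hsub, h0⟩))

theorem universalSigma_mono (𝔓 : Set (ProbabilityMeasure (PathSpace d))) :
    Monotone (universalSigma 𝔓) := fun _ _ hst =>
  iInf₂_mono fun P _ => sup_le_sup_right (sigmaCompleted_mono P hst) _

/-- The universal filtration `𝔽^𝔓`, on the time interval `[0,T]`. Its σ-algebras contain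
non-Borel sets, so it is a filtration of the largest σ-algebra of `Ω`. -/
def universalFiltration (𝔓 : Set (ProbabilityMeasure (PathSpace d))) (T : ℝ≥0) :
    Filtration (Set.Icc (0 : ℝ) T) (⊤ : MeasurableSpace (PathSpace d)) where
  seq t := universalSigma 𝔓 ⟨t.1, t.2.1⟩
  mono' _ _ hst := universalSigma_mono 𝔓 hst
  le' _ := le_top

/-- A Borel set `A` is polar if `P(A) = 0` for all `P ∈ 𝔓`. -/
def IsPolar (𝔓 : Set (ProbabilityMeasure (PathSpace d))) (A : Set (PathSpace d)) : Prop :=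
  MeasurableSet A ∧ ∀ P ∈ 𝔓, (P : Measure (PathSpace d)) A = 0

/-- A property holds `𝔓`-quasi-surely if it holds outside a polar set. -/
def QuasiSurely (𝔓 : Set (ProbabilityMeasure (PathSpace d))) (p : PathSpace d → Prop) : Prop :=
  ∃ A, IsPolar 𝔓 A ∧ ∀ ω, ω ∉ A → p ω

/-- In particular it then holds `P`-almost surely for every `P ∈ 𝔓`. -/
theorem QuasiSurely.ae {𝔓 : Set (ProbabilityMeasure (PathSpace d))} {p : PathSpace d → Prop}
    (h : QuasiSurely 𝔓 p) : ∀ P ∈ 𝔓, ∀ᵐ ω ∂(P : Measure (PathSpace d)), p ω := by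
  obtain ⟨A, hA, hp⟩ := h
  intro P hP
  filter_upwards [measure_eq_zero_iff_ae_notMem.1 (hA.2 P hP)] with ω hω using hp ω hω

end PathSpace

open PathSpace

/-- Lebesgue measure `dt` on the time interval `[0,T]`. -/
def lebesgueIcc (T : ℝ≥0) : Measure (Set.Icc (0 : ℝ) T) :=
  Measure.comap Subtype.val (volume : Measure ℝ)

theorem lebesgueIcc_univ (T : ℝ≥0) : lebesgueIcc T Set.univ = T := by
  rw [lebesgueIcc, comap_subtype_coe_apply measurableSet_Icc, Set.image_univ,
    Subtype.range_coe, Real.volume_Icc, sub_zero, ENNReal.ofReal_coe_nnreal]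

instance (T : ℝ≥0) : IsFiniteMeasure (lebesgueIcc T) :=
  ⟨by rw [lebesgueIcc_univ]; exact ENNReal.coe_lt_top⟩

/-- The space `𝕄([0,T] × U)`: measures on `[0,T] × U` whose projection on `[0,T]` is Lebesgue
measure. -/
structure TimeMeasure (T : ℝ≥0) (U : Type*) [MeasurableSpace U] where
  /-- the underlying measure -/
  toMeasure : Measure (Set.Icc (0 : ℝ) T × U)
  fst_eq : toMeasure.fst = lebesgueIcc T

namespace TimeMeasure

variable {T : ℝ≥0} {U : Type*} [MeasurableSpace U]

instance (q : TimeMeasure T U) : IsFiniteMeasure q.toMeasure :=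
  ⟨by rw [← Measure.fst_univ, q.fst_eq]; exact measure_lt_top _ _⟩

/-- The same measure, as a point of Mathlib's space of finite measures, which carries the
topology of weak convergence. -/
def toFiniteMeasure (q : TimeMeasure T U) : FiniteMeasure (Set.Icc (0 : ℝ) T × U) :=
  ⟨q.toMeasure, inferInstance⟩

/-- Test functions of stable convergence: bounded measurable `φ(t,a)`, continuous in `a`. -/
structure StableTest (T : ℝ≥0) (U : Type*) [MeasurableSpace U] [TopologicalSpace U] where
  /-- the underlying function -/
  toFun : Set.Icc (0 : ℝ) T × U → ℝ
  measurable : Measurable toFun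
  bounded : ∃ C : ℝ, ∀ x, |toFun x| ≤ C
  continuous : ∀ t, Continuous fun a => toFun (t, a)

/-- The topology of stable convergence: the coarsest one for which `q ↦ ∫ φ dq` is continuous
for every test function `φ`. -/
instance [TopologicalSpace U] : TopologicalSpace (TimeMeasure T U) :=
  ⨅ φ : StableTest T U,
    TopologicalSpace.induced (fun q : TimeMeasure T U => ∫ x, φ.toFun x ∂q.toMeasure) inferInstance

end TimeMeasure

/-- An `𝔽^𝔓`-progressively measurable process `(μ_t)_{t ∈ [0,T]}` with values in the probability
measures on `U`: each `(μ_t(A))_t`, `A` Borel, is progressively measurable. -/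
structure RelaxedControl {d : ℕ} (𝔓 : Set (ProbabilityMeasure (PathSpace d))) (T : ℝ≥0)
    (U : Type*) [MeasurableSpace U] where
  /-- the process -/
  toFun : Set.Icc (0 : ℝ) T → PathSpace d → ProbabilityMeasure U
  progressive : ∀ A : Set U, MeasurableSet A →
    IsProgressive (universalFiltration 𝔓 T) fun t ω => toFun t ω A

/-- An `𝔽^𝔓`-progressively measurable process `(u(t))_{t ∈ [0,T]}` with values in `U`. -/
structure StrictControl {d : ℕ} (𝔓 : Set (ProbabilityMeasure (PathSpace d))) (T : ℝ≥0)
    (U : Type*) [MeasurableSpace U] where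
  /-- the process -/
  toFun : Set.Icc (0 : ℝ) T → PathSpace d → U
  progressive : IsProgressive (universalFiltration 𝔓 T) toFun

variable {d : ℕ} {𝔓 : Set (ProbabilityMeasure (PathSpace d))} {T : ℝ≥0}
  {U : Type*} [MeasurableSpace U]

/-- For fixed `ω`, the kernel `t ↦ μ_t(ω, ·)`. -/
def RelaxedControl.kernel (μ : RelaxedControl 𝔓 T U) (ω : PathSpace d) :
    Kernel (Set.Icc (0 : ℝ) T) U where
  toFun t := (μ.toFun t ω : Measure U)
  measurable' := by
    refine Measure.measurable_of_measurable_coe _ fun A hA => ?_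
    have h := μ.progressive A hA ⟨T, T.2, le_rfl⟩
    have h2 : Measurable fun t : Set.Icc (0 : ℝ) T => μ.toFun t ω A :=
      h.comp ((measurable_id.subtype_mk (h := fun t => t.2.2)).prodMk measurable_const)
    simpa using h2.coe_nnreal_ennreal

instance (μ : RelaxedControl 𝔓 T U) (ω : PathSpace d) : IsMarkovKernel (μ.kernel ω) :=
  ⟨fun t => (μ.toFun t ω).2⟩

/-- The random measure `μ_t(ω, da) dt` on `[0,T] × U`. -/
def RelaxedControl.randomMeasure (μ : RelaxedControl 𝔓 T U) (ω : PathSpace d) :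
    TimeMeasure T U where
  toMeasure := lebesgueIcc T ⊗ₘ μ.kernel ω
  fst_eq := Measure.fst_compProd _ _

/-- The embedding of strict into relaxed controls, `u ↦ δ_{u(t)}(da)`. -/
def StrictControl.toRelaxed (u : StrictControl 𝔓 T U) : RelaxedControl 𝔓 T U where
  toFun t ω := ⟨Measure.dirac (u.toFun t ω), inferInstance⟩
  progressive A hA i := by
    have h : Measurable fun x : U => (Measure.dirac x A).toNNReal :=
      ((Measure.measurable_coe hA).comp Measure.measurable_dirac).ennreal_toNNReal
    exact h.comp (u.progressive i)

end

/-! The approximation is made path by path, with a recipe that looks only into the past. Let `e` be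
a dense sequence in `U`. Cut the time axis into blocks of length `1/(n+1)` and sort the points of
`U` by their nearest neighbour among `e 0, …, e n`. Within a block the control runs through these
points in order and gives each of them exactly the time that `μ` gave to its cell during the
preceding block. The times add up to the block length, so only the first `n` points need an exit
time: the last point is kept until the block ends.

Looking one block back has two effects. The control at time `t` is a measurable functional of `μ`
before `t`, hence progressive (`chatterIndex_congr`, `RelaxedControl.isProgressive_chatterIndex`).
And for an integrand frozen on a block, the integral along the control equals the integral against
the discretised `μ` over the preceding block, without error (`setIntegral_chatterIndex`).

For `Φ` continuous with compact support in time and values in `C(U, ℝ)`, freezing at grid points and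
rounding to nearest points are harmless in the limit by dominated convergence. General test
functions are integrable maps from time to `C(U, ℝ)`, and both integrals are 1-Lipschitz in the `L¹`
norm uniformly in `n`, so density concludes (`tendsto_integral_chatter`). Convergence holds along
every path; the exceptional polar set is empty. -/

/-! ### The chattering index -/

/-- The integral of `m · j` over the block `[(k-1)/(n+1), k/(n+1))`. -/
noncomputable def blockIntegral (m : ℝ → ℕ → ℝ) (n : ℕ) (k : ℤ) (j : ℕ) : ℝ :=
  ∫ s in Set.Ico (((k : ℝ) - 1) / (n + 1)) ((k : ℝ) / (n + 1)), m s j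

open Classical in
/-- The index of the point occupied at time `t`: inside each block of length `1/(n+1)` the points
are visited in order, and point `j` is left when the time spent in the block exceeds the integral of
`m · j` over the preceding block. -/
noncomputable def chatterIndex (m : ℝ → ℕ → ℝ) (n : ℕ) (t : ℝ) : ℕ :=
  ∑ j ∈ Finset.range n,
    if blockIntegral m n ⌊t * (n + 1)⌋ j ≤ t - ⌊t * (n + 1)⌋ / (n + 1) then 1 else 0

/-- The exit times used at `t` are integrals over a block that ends at or before `t`. This
non-anticipation is the source of adaptedness. -/
theorem chatterIndex_congr {m m' : ℝ → ℕ → ℝ} (n : ℕ) {t : ℝ} (h : ∀ s < t, m s = m' s) :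
    chatterIndex m n t = chatterIndex m' n t := by
  have key : ∀ j, blockIntegral m n ⌊t * (n + 1)⌋ j = blockIntegral m' n ⌊t * (n + 1)⌋ j := by
    intro j
    refine setIntegral_congr_fun measurableSet_Ico fun s hs => ?_
    have hn : (0 : ℝ) < n + 1 := by positivity
    have : (⌊t * (n + 1)⌋ : ℝ) / (n + 1) ≤ t := by
      rw [div_le_iff₀ hn]; exact Int.floor_le _
    simp only [h s (hs.2.trans_le this)]
  simp only [chatterIndex, key]

theorem measurable_blockIntegral {Ω : Type*} [MeasurableSpace Ω] {m : Ω → ℝ → ℕ → ℝ} {j : ℕ}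
    (hm : Measurable fun p : ℝ × Ω => m p.2 p.1 j) (n : ℕ) (k : ℤ) :
    Measurable fun ω => blockIntegral (m ω) n k j :=
  (StronglyMeasurable.integral_prod_left' (f := fun p : ℝ × Ω => m p.2 p.1 j)
    hm.stronglyMeasurable).measurable

theorem measurable_chatterIndex {Ω : Type*} [MeasurableSpace Ω] {m : Ω → ℝ → ℕ → ℝ}
    (hm : ∀ j, Measurable fun p : ℝ × Ω => m p.2 p.1 j) (n : ℕ) :
    Measurable fun p : ℝ × Ω => chatterIndex (m p.2) n p.1 := by
  have hk : Measurable fun p : ℝ × Ω => ⌊p.1 * (n + 1)⌋ :=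
    Int.measurable_floor.comp (measurable_fst.mul_const _)
  have h₁ : ∀ j, Measurable fun p : ℝ × Ω => blockIntegral (m p.2) n ⌊p.1 * (n + 1)⌋ j := by
    intro j
    -- The block number takes countably many values, so joint measurability reduces to a fixed
    -- block.
    have h : Measurable fun q : ℤ × Ω => blockIntegral (m q.2) n q.1 j :=
      measurable_from_prod_countable_right fun k => measurable_blockIntegral (hm j) n k
    have hq : Measurable fun p : ℝ × Ω => (⌊p.1 * (n + 1)⌋, p.2) := hk.prodMk measurable_snd
    have h' := h.comp hq
    simp only [Function.comp_def] at h'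
    exact h'
  have h₂ : Measurable fun p : ℝ × Ω => p.1 - (⌊p.1 * (n + 1)⌋ : ℝ) / (n + 1) := by
    have h : Measurable fun k : ℤ => (k : ℝ) := measurable_from_top
    exact measurable_fst.sub ((h.comp hk).div_const _)
  unfold chatterIndex
  exact Finset.measurable_sum _ fun j _ =>
    Measurable.ite (measurableSet_le (h₁ j) h₂) measurable_const measurable_const

/-- The inner sum is the length of the initial segment where `p` holds, and the increments of `f`
telescope along it. A function of the index thus becomes a combination of threshold indicators,
whose integrals are explicit. -/
theorem apply_sum_ite_one (f : ℕ → ℝ) {p : ℕ → Prop} [DecidablePred p]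
    (hp : ∀ i j, i ≤ j → p j → p i) (n : ℕ) :
    f (∑ j ∈ Finset.range n, if p j then 1 else 0) =
      f 0 + ∑ j ∈ Finset.range n, if p j then f (j + 1) - f j else 0 := by
  induction n with
  | zero => simp
  | succ n ih =>
    rw [Finset.sum_range_succ, Finset.sum_range_succ]
    by_cases h : p n
    · have h1 : ∑ j ∈ Finset.range n, (if p j then 1 else 0) = n := by
        rw [Finset.sum_congr rfl (g := fun _ => 1)]
        · simp
        · intro j hj
          rw [if_pos (hp j n (Finset.mem_range.1 hj).le h)]
      rw [h1] at ih ⊢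
      simp only [h, if_true]
      linarith
    · simp only [h, if_false, add_zero, ih]

theorem apply_eq_sum_of_le (f : ℕ → ℝ) {i n : ℕ} (hi : i ≤ n) :
    f i = f 0 + ∑ j ∈ Finset.range n, if j < i then f (j + 1) - f j else 0 := by
  rw [← apply_sum_ite_one f (p := fun j => j < i) fun _ _ h h' => lt_of_le_of_lt h h']
  congr 1
  rw [← Finset.sum_filter, Finset.sum_const, smul_eq_mul, mul_one]
  have : Finset.filter (fun j => j < i) (Finset.range n) = Finset.range i := by
    ext j; simp only [Finset.mem_filter, Finset.mem_range]; omega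
  rw [this, Finset.card_range]

/-! ### Occupation times over one block. -/

section Block

variable {U : Type*} [MeasurableSpace U] (κ : Kernel ℝ U)

/-- The distribution functions of an index under a kernel. -/
noncomputable def indexCdf (κ : Kernel ℝ U) (ind : U → ℕ) (s : ℝ) (j : ℕ) : ℝ :=
  (κ s).real {a | ind a ≤ j}

variable {ind : U → ℕ}

theorem measurable_indexCdf (hind : Measurable ind) (j : ℕ) :
    Measurable fun s => indexCdf κ ind s j :=
  (κ.measurable_coe (hind (measurableSet_Iic (a := j)))).ennreal_toReal

theorem blockIntegral_indexCdf_nonneg (n : ℕ) (k : ℤ) (j : ℕ) :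
    0 ≤ blockIntegral (indexCdf κ ind) n k j :=
  integral_nonneg fun _ => measureReal_nonneg

variable [IsMarkovKernel κ]

theorem integrableOn_indexCdf (hind : Measurable ind) (j : ℕ) (a b : ℝ) :
    IntegrableOn (fun s => indexCdf κ ind s j) (Set.Ico a b) := by
  refine Measure.integrableOn_of_bounded (M := 1) (by simp)
    (measurable_indexCdf κ hind j).aestronglyMeasurable (Eventually.of_forall fun s => ?_)
  rw [indexCdf, Real.norm_eq_abs, abs_of_nonneg measureReal_nonneg]
  exact measureReal_le_one

theorem volume_real_block (n : ℕ) (k : ℝ) :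
    volume.real (Set.Ico ((k - 1) / ((n : ℝ) + 1)) (k / (n + 1))) = 1 / (n + 1) := by
  have hn : (0 : ℝ) < n + 1 := by positivity
  rw [Real.volume_real_Ico_of_le (by gcongr; linarith)]
  ring

theorem blockIntegral_indexCdf_mono (hind : Measurable ind) (n : ℕ) (k : ℤ) :
    Monotone (blockIntegral (indexCdf κ ind) n k) := fun i j hij =>
  setIntegral_mono (integrableOn_indexCdf κ hind i _ _) (integrableOn_indexCdf κ hind j _ _)
    fun _ => measureReal_mono fun _ ha => le_trans ha hij

theorem blockIntegral_indexCdf_le (hind : Measurable ind) (n : ℕ) (k : ℤ) (j : ℕ) :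
    blockIntegral (indexCdf κ ind) n k j ≤ 1 / (n + 1) := by
  calc blockIntegral (indexCdf κ ind) n k j
      ≤ ∫ _ in Set.Ico (((k : ℝ) - 1) / (n + 1)) ((k : ℝ) / (n + 1)), (1 : ℝ) :=
        setIntegral_mono (integrableOn_indexCdf κ hind j _ _) (by simp) fun _ => measureReal_le_one
    _ = 1 / (n + 1) := by rw [setIntegral_const, volume_real_block, smul_eq_mul, mul_one]

theorem floor_eq_of_mem_block {n : ℕ} {k : ℤ} {t : ℝ}
    (ht : t ∈ Set.Ico ((k : ℝ) / (n + 1)) (((k : ℝ) + 1) / (n + 1))) : ⌊t * (n + 1)⌋ = k := by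
  have hn : (0 : ℝ) < n + 1 := by positivity
  rw [Int.floor_eq_iff]
  exact ⟨(div_le_iff₀ hn).1 ht.1, (lt_div_iff₀ hn).1 ht.2⟩

/-- Over a block, the chattering index has the occupation measure that `κ` gives to the index
over the preceding block. -/
theorem setIntegral_chatterIndex (hind : Measurable ind) {n : ℕ} (hn : ∀ a, ind a ≤ n) (k : ℤ)
    (f : ℕ → ℝ) :
    ∫ t in Set.Ico ((k : ℝ) / (n + 1)) (((k : ℝ) + 1) / (n + 1)),
        f (chatterIndex (indexCdf κ ind) n t) =
      ∫ s in Set.Ico (((k : ℝ) - 1) / (n + 1)) ((k : ℝ) / (n + 1)), ∫ a, f (ind a) ∂κ s := by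
  classical
  set c := blockIntegral (indexCdf κ ind) n k with hc
  have hn0 : (0 : ℝ) < n + 1 := by positivity
  have hvol : volume.real (Set.Ico ((k : ℝ) / (n + 1)) (((k : ℝ) + 1) / (n + 1))) = 1 / (n + 1) := by
    simpa using volume_real_block n ((k : ℝ) + 1)
  -- Both sides are expanded in the increments of `f`. Here the increment at `j` is weighted by the
  -- time left in the block after point `j` is abandoned.
  have hL : ∫ t in Set.Ico ((k : ℝ) / (n + 1)) (((k : ℝ) + 1) / (n + 1)),
        f (chatterIndex (indexCdf κ ind) n t) =
      1 / (n + 1) * f 0 + ∑ j ∈ Finset.range n, (f (j + 1) - f j) * (1 / (n + 1) - c j) := by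
    have h1 : ∀ t ∈ Set.Ico ((k : ℝ) / (n + 1)) (((k : ℝ) + 1) / (n + 1)),
        f (chatterIndex (indexCdf κ ind) n t) = f 0 + ∑ j ∈ Finset.range n,
          (Set.Ici ((k : ℝ) / (n + 1) + c j)).indicator (fun _ => f (j + 1) - f j) t := by
      intro t ht
      rw [chatterIndex, floor_eq_of_mem_block ht, apply_sum_ite_one f]
      · congr 1
        refine Finset.sum_congr rfl fun j _ => ?_
        simp only [Set.indicator_apply, Set.mem_Ici, le_sub_iff_add_le']
        rfl
      · exact fun i j hij h => (blockIntegral_indexCdf_mono κ hind n k hij).trans h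
    have hi : ∀ j, IntegrableOn ((Set.Ici ((k : ℝ) / (n + 1) + c j)).indicator
        (fun _ => f (j + 1) - f j)) (Set.Ico ((k : ℝ) / (n + 1)) (((k : ℝ) + 1) / (n + 1))) :=
      fun j => (integrable_const _).indicator measurableSet_Ici
    rw [setIntegral_congr_fun measurableSet_Ico h1, integral_add (integrable_const _)
      (integrable_finsetSum _ fun j _ => hi j), setIntegral_const, hvol, smul_eq_mul,
      integral_finsetSum _ fun j _ => hi j]
    congr 1
    refine Finset.sum_congr rfl fun j _ => ?_
    rw [setIntegral_indicator measurableSet_Ici, setIntegral_const, smul_eq_mul, mul_comm]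
    congr 1
    -- The exit time lies in the closed block because `0 ≤ c j ≤ 1/(n+1)`, so no length is
    -- truncated.
    have h2 : Set.Ico ((k : ℝ) / (n + 1)) (((k : ℝ) + 1) / (n + 1)) ∩
        Set.Ici ((k : ℝ) / (n + 1) + c j) =
        Set.Ico ((k : ℝ) / (n + 1) + c j) (((k : ℝ) + 1) / (n + 1)) := by
      rw [Set.Ico_inter_Ici, max_eq_right]
      linarith [blockIntegral_indexCdf_nonneg κ (ind := ind) n k j]
    have h3 := blockIntegral_indexCdf_le κ hind n k j
    have h4 : ((k : ℝ) + 1) / (n + 1) = k / (n + 1) + 1 / (n + 1) := add_div _ _ _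
    rw [h2, Real.volume_real_Ico_of_le (by rw [h4]; linarith), h4]
    ring
  -- The same expansion under `κ s`: the weight is now the probability that the index exceeds `j`,
  -- and its integral over the preceding block is `1/(n+1) - c j`.
  have hR : ∀ s, ∫ a, f (ind a) ∂κ s =
      f 0 + ∑ j ∈ Finset.range n, (f (j + 1) - f j) * (1 - indexCdf κ ind s j) := by
    intro s
    have h1 : ∀ a, f (ind a) = f 0 + ∑ j ∈ Finset.range n,
        ({a | ind a ≤ j}ᶜ).indicator (fun _ => f (j + 1) - f j) a := by
      intro a
      rw [apply_eq_sum_of_le f (hn a)]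
      simp only [Set.indicator_apply, Set.mem_compl_iff, Set.mem_ofPred_eq, not_le]
    have hms : ∀ j, MeasurableSet {a | ind a ≤ j} := fun j => hind measurableSet_Iic
    have hi : ∀ j, Integrable (({a | ind a ≤ j}ᶜ).indicator (fun _ => f (j + 1) - f j)) (κ s) :=
      fun j => (integrable_const _).indicator (hms j).compl
    simp_rw [h1]
    rw [integral_add (integrable_const _) (integrable_finsetSum _ fun j _ => hi j),
      integral_finsetSum _ fun j _ => hi j, integral_const, probReal_univ, one_smul]
    congr 1
    refine Finset.sum_congr rfl fun j _ => ?_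
    rw [integral_indicator (hms j).compl, setIntegral_const, smul_eq_mul, mul_comm,
      probReal_compl_eq_one_sub (hms j), indexCdf]
  have hi : ∀ j, IntegrableOn (fun s => (f (j + 1) - f j) * (1 - indexCdf κ ind s j))
      (Set.Ico (((k : ℝ) - 1) / (n + 1)) ((k : ℝ) / (n + 1))) := fun j =>
    ((integrable_const _).sub (integrableOn_indexCdf κ hind j _ _)).const_mul _
  rw [hL]
  simp_rw [hR]
  rw [integral_add (integrable_const _) (integrable_finsetSum _ fun j _ => hi j),
      integral_finsetSum _ fun j _ => hi j, setIntegral_const, volume_real_block, smul_eq_mul]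
  congr 1
  refine Finset.sum_congr rfl fun j _ => ?_
  rw [integral_const_mul, integral_sub (integrable_const _) (integrableOn_indexCdf κ hind j _ _),
    setIntegral_const, volume_real_block, smul_eq_mul, mul_one]
  rfl

end Block

/-- The blocks partition the whole line and the shift by one block is a bijection of `ℤ`. Working on
`ℝ` rather than on `[0,T]` leaves no boundary term. -/
theorem integral_eq_of_setIntegral_block_eq {g G : ℝ → ℝ} (hg : Integrable g) (hG : Integrable G)
    (n : ℕ)
    (h : ∀ k : ℤ, ∫ t in Set.Ico ((k : ℝ) / (n + 1)) (((k : ℝ) + 1) / (n + 1)), g t =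
      ∫ t in Set.Ico (((k : ℝ) - 1) / (n + 1)) ((k : ℝ) / (n + 1)), G t) :
    ∫ t, g t = ∫ t, G t := by
  have hn : (0 : ℝ) < 1 / (n + 1) := by positivity
  have key : ∀ F : ℝ → ℝ, Integrable F → ∫ t, F t =
      ∑' k : ℤ, ∫ t in Set.Ico ((k : ℝ) / (n + 1)) (((k : ℝ) + 1) / (n + 1)), F t := by
    intro F hF
    have h1 := integral_iUnion (μ := volume)
      (s := fun k : ℤ => Set.Ico (k • (1 / ((n : ℝ) + 1))) ((k + 1) • (1 / ((n : ℝ) + 1))))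
      (fun _ => measurableSet_Ico) (Set.pairwise_disjoint_Ico_zsmul _) hF.integrableOn
    rw [iUnion_Ico_zsmul hn, setIntegral_univ] at h1
    rw [h1]
    refine tsum_congr fun k => ?_
    simp only [zsmul_eq_mul, mul_one_div, Int.cast_add, Int.cast_one]
  rw [key g hg, key G hG, ← (Equiv.subRight (1 : ℤ)).tsum_eq
    fun k : ℤ => ∫ t in Set.Ico ((k : ℝ) / (n + 1)) (((k : ℝ) + 1) / (n + 1)), G t]
  refine tsum_congr fun k => ?_
  simp only [h k, Equiv.subRight_apply, Int.cast_sub, Int.cast_one, sub_add_cancel]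

/-! ### Pathwise convergence of chattering controls -/

theorem abs_floor_div_sub_le (n : ℕ) (t : ℝ) :
    |(⌊t * (n + 1)⌋ : ℝ) / (n + 1) - t| ≤ 1 / ((n : ℝ) + 1) := by
  have hn : (0 : ℝ) < n + 1 := by positivity
  have h1 : (⌊t * (n + 1)⌋ : ℝ) / (n + 1) - t = (⌊t * (n + 1)⌋ - t * (n + 1)) / (n + 1) := by
    field_simp
  rw [h1, abs_div, abs_of_pos hn]
  gcongr
  rw [abs_le]
  constructor <;> linarith [Int.floor_le (t * (n + 1)), Int.lt_floor_add_one (t * (n + 1))]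

theorem abs_floor_add_one_div_sub_le (n : ℕ) (t : ℝ) :
    |((⌊t * (n + 1)⌋ : ℝ) + 1) / (n + 1) - t| ≤ 1 / ((n : ℝ) + 1) := by
  have hn : (0 : ℝ) < n + 1 := by positivity
  have h1 : ((⌊t * (n + 1)⌋ : ℝ) + 1) / (n + 1) - t = (⌊t * (n + 1)⌋ + 1 - t * (n + 1)) / (n + 1) := by
    field_simp
  rw [h1, abs_div, abs_of_pos hn]
  gcongr
  rw [abs_le]
  constructor <;> linarith [Int.floor_le (t * (n + 1)), Int.lt_floor_add_one (t * (n + 1))]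

theorem tendsto_of_abs_sub_le_one_div {r : ℕ → ℝ} {t : ℝ}
    (h : ∀ n : ℕ, |r n - t| ≤ 1 / ((n : ℝ) + 1)) : Tendsto r atTop (𝓝 t) :=
  tendsto_iff_dist_tendsto_zero.2
    (squeeze_zero (fun _ => dist_nonneg) h tendsto_one_div_add_atTop_nhds_zero_nat)

theorem one_div_nat_add_one_le (n : ℕ) : 1 / ((n : ℝ) + 1) ≤ 1 := by
  rw [div_le_one (by positivity)]
  linarith [n.cast_nonneg (α := ℝ)]

theorem measurable_floor_cast (n : ℕ) : Measurable fun t : ℝ => (⌊t * (n + 1)⌋ : ℝ) := by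
  have h : Measurable fun k : ℤ => (k : ℝ) := measurable_from_top
  exact h.comp (Int.measurable_floor.comp (measurable_id.mul_const _))

/-- One integrable majorant for `Φ` evaluated at grid points, uniform in the mesh since the mesh is
at most 1: a constant on a bounded interval that contains the support, widened by 1 on each side. -/
theorem HasCompactSupport.exists_integrable_norm_le_of_abs_sub_le_one {E : Type*}
    [NormedAddCommGroup E] {Φ : ℝ → E} (hΦ : Continuous Φ) (hs : HasCompactSupport Φ) :
    ∃ b : ℝ → ℝ, Integrable b ∧ ∀ r t, |r - t| ≤ 1 → ‖Φ r‖ ≤ b t := by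
  obtain ⟨C, hC⟩ := hs.exists_bound_of_continuous hΦ
  obtain ⟨R, hR⟩ := hs.isCompact.isBounded.subset_closedBall 0
  refine ⟨(Set.Icc (-R - 1) (R + 1)).indicator fun _ => C,
    (integrable_indicator_iff measurableSet_Icc).2 (by simp), fun r t hrt => ?_⟩
  have hC0 : 0 ≤ C := (norm_nonneg _).trans (hC r)
  by_cases hr : Φ r = 0
  · rw [hr, norm_zero]
    exact Set.indicator_nonneg (fun _ _ => hC0) t
  · have h1 := hR (subset_tsupport Φ hr)
    rw [mem_closedBall_zero_iff, Real.norm_eq_abs, abs_le] at h1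
    rw [abs_le] at hrt
    rw [Set.indicator_of_mem (show t ∈ Set.Icc (-R - 1) (R + 1) from ⟨by linarith, by linarith⟩)]
    exact hC r

section Chattering

theorem ContinuousMap.norm_integral_le {U : Type*} [TopologicalSpace U] [CompactSpace U]
    [MeasurableSpace U] (ν : Measure U) [IsProbabilityMeasure ν] (f : C(U, ℝ)) :
    ‖∫ a, f a ∂ν‖ ≤ ‖f‖ := by
  refine (norm_integral_le_of_norm_le_const (Eventually.of_forall f.norm_coe_le_norm)).trans ?_
  rw [probReal_univ, mul_one]

variable {U : Type*} [MetricSpace U] [MeasurableSpace U] [BorelSpace U]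

/-- The chattering control of mesh `1/(n+1)` that imitates the kernel `κ`. -/
noncomputable def chatter (e : ℕ → U) (κ : Kernel ℝ U) (n : ℕ) (t : ℝ) : U :=
  e (chatterIndex (indexCdf κ (SimpleFunc.nearestPtInd e n)) n t)

theorem measurable_chatter (κ : Kernel ℝ U) (e : ℕ → U) (n : ℕ) : Measurable (chatter e κ n) := by
  have h := measurable_chatterIndex (Ω := Unit)
    (m := fun _ => indexCdf κ (SimpleFunc.nearestPtInd e n))
    (fun j => (measurable_indexCdf κ (SimpleFunc.nearestPtInd e n).measurable j).comp
      measurable_fst) n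
  have h' := h.comp (measurable_prodMk_right (y := ()))
  exact measurable_from_top.comp h'

variable [CompactSpace U]

theorem ContinuousMap.integrable_apply_of_integrable {α : Type*} [MeasurableSpace α]
    {ν : Measure α} {Φ : α → C(U, ℝ)} (hΦ : Integrable Φ ν) {u : α → U} (hu : Measurable u) :
    Integrable (fun t => Φ t (u t)) ν :=
  hΦ.norm.mono'
    (continuous_eval.comp_aestronglyMeasurable
      (hΦ.aestronglyMeasurable.prodMk hu.stronglyMeasurable.aestronglyMeasurable))
    (Eventually.of_forall fun t => (Φ t).norm_coe_le_norm _)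

variable (κ : Kernel ℝ U) [IsMarkovKernel κ]

theorem ContinuousMap.integrable_integral_of_integrable {Φ : ℝ → C(U, ℝ)}
    (hm : StronglyMeasurable Φ) (hΦ : Integrable Φ) : Integrable fun s => ∫ a, Φ s a ∂κ s := by
  refine hΦ.norm.mono' (StronglyMeasurable.integral_kernel_prod_right' (κ := κ)
    (f := fun p : ℝ × U => Φ p.1 p.2) ?_).aestronglyMeasurable
    (Eventually.of_forall fun s => ContinuousMap.norm_integral_le _ _)
  exact continuous_eval.comp_stronglyMeasurable
    ((hm.comp_measurable measurable_fst).prodMk measurable_snd.stronglyMeasurable)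

variable (e : ℕ → U)

/-- On the control side `Φ` is frozen at the left end `r n t` of the block of `t`, on the kernel
side at the right end `r' n s` of the block of `s`. For consecutive blocks these are the same grid
point, so the block identity applies to the frozen integrands. -/
theorem tendsto_integral_chatter_of_hasCompactSupport (he : DenseRange e) {Φ : ℝ → C(U, ℝ)}
    (hΦ : Continuous Φ) (hs : HasCompactSupport Φ) :
    Tendsto (fun n => ∫ t, Φ t (chatter e κ n t)) atTop (𝓝 (∫ s, ∫ a, Φ s a ∂κ s)) := by
  obtain ⟨b, hb, hΦb⟩ := hs.exists_integrable_norm_le_of_abs_sub_le_one hΦ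
  have hΦi : Integrable Φ := hΦ.integrable_of_hasCompactSupport hs
  set r : ℕ → ℝ → ℝ := fun n t => (⌊t * (n + 1)⌋ : ℝ) / (n + 1) with hr
  set r' : ℕ → ℝ → ℝ := fun n t => ((⌊t * (n + 1)⌋ : ℝ) + 1) / (n + 1) with hr'
  have hrm : ∀ n, Measurable (r n) := fun n => (measurable_floor_cast n).div_const _
  have hrm' : ∀ n, Measurable (r' n) := fun n => ((measurable_floor_cast n).add_const _).div_const _
  have hrt : ∀ t, Tendsto (fun n => r n t) atTop (𝓝 t) := fun t =>
    tendsto_of_abs_sub_le_one_div fun n => abs_floor_div_sub_le n t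
  have hrt' : ∀ t, Tendsto (fun n => r' n t) atTop (𝓝 t) := fun t =>
    tendsto_of_abs_sub_le_one_div fun n => abs_floor_add_one_div_sub_le n t
  have hrb : ∀ n t, ‖Φ (r n t)‖ ≤ b t := fun n t =>
    hΦb _ _ ((abs_floor_div_sub_le n t).trans (one_div_nat_add_one_le n))
  have hrb' : ∀ n t, ‖Φ (r' n t)‖ ≤ b t := fun n t =>
    hΦb _ _ ((abs_floor_add_one_div_sub_le n t).trans (one_div_nat_add_one_le n))
  have hΦr : ∀ n, StronglyMeasurable fun t => Φ (r n t) := fun n =>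
    hΦ.comp_stronglyMeasurable (hrm n).stronglyMeasurable
  have hΦri : ∀ n, Integrable fun t => Φ (r n t) := fun n =>
    hb.mono' (hΦr n).aestronglyMeasurable (Eventually.of_forall (hrb n))
  have hg : ∀ n, Integrable fun t => Φ (r n t) (chatter e κ n t) := fun n =>
    ContinuousMap.integrable_apply_of_integrable (hΦri n) (measurable_chatter κ e n)
  have hGm : ∀ n, StronglyMeasurable fun s => ∫ a, Φ (r' n s) (SimpleFunc.nearestPt e n a) ∂κ s := by
    intro n
    refine StronglyMeasurable.integral_kernel_prod_right' (κ := κ)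
      (f := fun p : ℝ × U => Φ (r' n p.1) (SimpleFunc.nearestPt e n p.2)) ?_
    exact continuous_eval.comp_stronglyMeasurable
      ((hΦ.comp_stronglyMeasurable ((hrm' n).comp measurable_fst).stronglyMeasurable).prodMk
        ((SimpleFunc.nearestPt e n).measurable.comp measurable_snd).stronglyMeasurable)
  have hGb : ∀ n s, ‖∫ a, Φ (r' n s) (SimpleFunc.nearestPt e n a) ∂κ s‖ ≤ b s := by
    intro n s
    refine (norm_integral_le_of_norm_le_const (C := b s) (Eventually.of_forall fun a =>
      ((Φ (r' n s)).norm_coe_le_norm _).trans (hrb' n s))).trans ?_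
    rw [probReal_univ, mul_one]
  have hG : ∀ n, Integrable fun s => ∫ a, Φ (r' n s) (SimpleFunc.nearestPt e n a) ∂κ s := fun n =>
    hb.mono' (hGm n).aestronglyMeasurable (Eventually.of_forall (hGb n))
  have heq : ∀ n, ∫ t, Φ (r n t) (chatter e κ n t) =
      ∫ s, ∫ a, Φ (r' n s) (SimpleFunc.nearestPt e n a) ∂κ s := by
    intro n
    refine integral_eq_of_setIntegral_block_eq (hg n) (hG n) n fun k => ?_
    have h := setIntegral_chatterIndex κ (SimpleFunc.nearestPtInd e n).measurable
      (SimpleFunc.nearestPtInd_le e n) k fun i => Φ ((k : ℝ) / (n + 1)) (e i)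
    refine Eq.trans (setIntegral_congr_fun measurableSet_Ico fun t ht => ?_)
      (h.trans (setIntegral_congr_fun measurableSet_Ico fun s hs => ?_))
    · simp only [hr, floor_eq_of_mem_block ht]
      rfl
    -- Here `s` runs through the preceding block, whose right end is again `k/(n+1)`.
    · have hk : ⌊s * ((n : ℝ) + 1)⌋ = k - 1 := floor_eq_of_mem_block (by simpa using hs)
      simp only [hr', hk, Int.cast_sub, Int.cast_one, sub_add_cancel]
      rfl
  have hlim : Tendsto (fun n => ∫ s, ∫ a, Φ (r' n s) (SimpleFunc.nearestPt e n a) ∂κ s) atTop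
      (𝓝 (∫ s, ∫ a, Φ s a ∂κ s)) := by
    refine tendsto_integral_of_dominated_convergence b (fun n => (hGm n).aestronglyMeasurable) hb
      (fun n => Eventually.of_forall (hGb n)) (Eventually.of_forall fun s => ?_)
    refine tendsto_integral_of_dominated_convergence (fun _ => b s)
      (fun n => ((Φ (r' n s)).continuous.measurable.comp
        (SimpleFunc.nearestPt e n).measurable).aestronglyMeasurable)
      (integrable_const _) (fun n => Eventually.of_forall fun a =>
        ((Φ (r' n s)).norm_coe_le_norm _).trans (hrb' n s)) (Eventually.of_forall fun a => ?_)
    have h1 : Tendsto (fun n => Φ (r' n s)) atTop (𝓝 (Φ s)) := (hΦ.tendsto s).comp (hrt' s)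
    have h2 : Tendsto (fun n => SimpleFunc.nearestPt e n a) atTop (𝓝 a) :=
      SimpleFunc.tendsto_nearestPt (he a)
    exact (continuous_eval.tendsto (Φ s, a)).comp (h1.prodMk_nhds h2)
  -- The freezing error is measured in the sup norm over `U`, so it is controlled whatever point the
  -- control occupies.
  have hdiff : Tendsto (fun n => ∫ t, ‖Φ t - Φ (r n t)‖) atTop (𝓝 0) := by
    have h := tendsto_integral_of_dominated_convergence (μ := volume)
      (F := fun n t => ‖Φ t - Φ (r n t)‖) (f := fun _ => (0 : ℝ)) (fun t => b t + b t)
      (fun n => (hΦ.stronglyMeasurable.sub (hΦr n)).norm.aestronglyMeasurable) (hb.add hb)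
      (fun n => Eventually.of_forall fun t => ?_) (Eventually.of_forall fun t => ?_)
    · simpa using h
    · rw [norm_norm]
      exact (norm_sub_le _ _).trans (add_le_add (hΦb t t (by simp)) (hrb n t))
    · have h1 : Tendsto (fun n => Φ (r n t)) atTop (𝓝 (Φ t)) := (hΦ.tendsto t).comp (hrt t)
      simpa using ((tendsto_const_nhds (x := Φ t)).sub h1).norm
  have hdiff' : Tendsto (fun n => (∫ t, Φ t (chatter e κ n t)) - ∫ t, Φ (r n t) (chatter e κ n t))
      atTop (𝓝 0) := by
    refine squeeze_zero_norm (fun n => ?_) hdiff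
    rw [← integral_sub (ContinuousMap.integrable_apply_of_integrable hΦi (measurable_chatter κ e n))
      (hg n)]
    refine norm_integral_le_of_norm_le (hΦi.sub (hΦri n)).norm (Eventually.of_forall fun t => ?_)
    exact (Φ t - Φ (r n t)).norm_coe_le_norm _
  have h := hdiff'.add hlim
  simpa only [← heq, sub_add_cancel, zero_add] using h

/-- Continuous compactly supported maps are dense in `L¹(ℝ; C(U, ℝ))`. Replacing `Φ` by such a map
changes each of the two integrals by at most the `L¹` distance, for every `n` at once. -/
theorem tendsto_integral_chatter (he : DenseRange e) {Φ : ℝ → C(U, ℝ)}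
    (hm : StronglyMeasurable Φ) (hΦ : Integrable Φ) :
    Tendsto (fun n => ∫ t, Φ t (chatter e κ n t)) atTop (𝓝 (∫ s, ∫ a, Φ s a ∂κ s)) := by
  rw [Metric.tendsto_atTop]
  intro ε hε
  obtain ⟨Ψ, hs, hle, hc, hΨ⟩ := hΦ.exists_hasCompactSupport_integral_sub_le
    (show 0 < ε / 3 by positivity)
  obtain ⟨N, hN⟩ := Metric.tendsto_atTop.1
    (tendsto_integral_chatter_of_hasCompactSupport κ e he hc hs) (ε / 3) (by positivity)
  refine ⟨N, fun n hn => ?_⟩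
  have h1 : dist (∫ t, Φ t (chatter e κ n t)) (∫ t, Ψ t (chatter e κ n t)) ≤ ε / 3 := by
    rw [dist_eq_norm, ← integral_sub
      (ContinuousMap.integrable_apply_of_integrable hΦ (measurable_chatter κ e n))
      (ContinuousMap.integrable_apply_of_integrable hΨ (measurable_chatter κ e n))]
    exact (norm_integral_le_of_norm_le (hΦ.sub hΨ).norm (Eventually.of_forall fun t =>
      (Φ t - Ψ t).norm_coe_le_norm _)).trans hle
  have h2 : dist (∫ s, ∫ a, Ψ s a ∂κ s) (∫ s, ∫ a, Φ s a ∂κ s) ≤ ε / 3 := by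
    rw [dist_comm, dist_eq_norm, ← integral_sub
      (ContinuousMap.integrable_integral_of_integrable κ hm hΦ)
      (ContinuousMap.integrable_integral_of_integrable κ hc.stronglyMeasurable hΨ)]
    refine (norm_integral_le_of_norm_le (hΦ.sub hΨ).norm (Eventually.of_forall fun s => ?_)).trans
      hle
    have hi : ∀ f : C(U, ℝ), Integrable (fun a => f a) (κ s) := fun f =>
      f.continuous.integrable_of_hasCompactSupport (HasCompactSupport.of_compactSpace _)
    rw [← integral_sub (hi _) (hi _)]
    exact ContinuousMap.norm_integral_le (κ s) (Φ s - Ψ s)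
  calc _ ≤ _ := dist_triangle4 _ _ _ _
    _ < ε / 3 + ε / 3 + ε / 3 := add_lt_add_of_lt_of_le (add_lt_add_of_le_of_lt h1 (hN n hn)) h2
    _ = ε := by ring

end Chattering

/-! ### Measurability into the space of continuous functions -/

/-- The sup distance to a fixed function is determined on a countable dense subset of `U`, so
preimages of balls are measurable. As `C(U, ℝ)` is separable, every open set is a countable union of
balls. -/
theorem ContinuousMap.stronglyMeasurable_of_measurable_apply {α U : Type*} [MeasurableSpace α]
    [TopologicalSpace U] [CompactSpace U] [TopologicalSpace.MetrizableSpace U]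
    {Φ : α → C(U, ℝ)} (h : ∀ a, Measurable fun t => Φ t a) : StronglyMeasurable Φ := by
  let := TopologicalSpace.metrizableSpaceMetric U
  borelize C(U, ℝ)
  obtain ⟨D, hDc, hDd⟩ := TopologicalSpace.exists_countable_dense U
  have hdist : ∀ g : C(U, ℝ), Measurable fun t => dist (Φ t) g := by
    intro g
    refine measurable_of_Iic fun C => ?_
    rcases lt_or_ge C 0 with hC | hC
    · convert! MeasurableSet.empty
      ext t
      simp only [Set.mem_preimage, Set.mem_Iic, Set.mem_empty_iff_false, iff_false, not_le]
      exact hC.trans_le dist_nonneg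
    · have : (fun t => dist (Φ t) g) ⁻¹' Set.Iic C = ⋂ a ∈ D, {t | dist (Φ t a) (g a) ≤ C} := by
        ext t
        simp only [Set.mem_preimage, Set.mem_Iic, Set.mem_iInter, Set.mem_ofPred_eq,
          ContinuousMap.dist_le hC]
        refine ⟨fun H a _ => H a, fun H a => ?_⟩
        exact (isClosed_le ((Φ t).continuous.dist g.continuous) continuous_const).closure_subset_iff.2
          H (hDd a)
      rw [this]
      exact MeasurableSet.biInter hDc fun a _ =>
        measurableSet_le ((h a).dist measurable_const) measurable_const
  refine Measurable.stronglyMeasurable (measurable_of_isOpen fun O hO => ?_)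
  choose! r hr0 hr using Metric.isOpen_iff.1 hO
  obtain ⟨S, hSO, hSc, hS⟩ := TopologicalSpace.isOpen_biUnion_countable O
    (fun g => Metric.ball g (r g)) fun _ _ => Metric.isOpen_ball
  have hO' : O = ⋃ g ∈ S, Metric.ball g (r g) := by
    rw [hS]
    exact Set.Subset.antisymm (fun g hg => Set.mem_biUnion hg (Metric.mem_ball_self (hr0 g hg)))
      (Set.iUnion₂_subset hr)
  rw [hO', Set.preimage_iUnion₂]
  exact MeasurableSet.biUnion hSc fun g _ => measurableSet_lt (hdist g) measurable_const

/-! ### Stable convergence -/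

theorem TimeMeasure.tendsto_iff_forall_integral_tendsto {T : ℝ≥0} {U : Type*} [MeasurableSpace U]
    [TopologicalSpace U] {ι : Type*} {l : Filter ι} {q : ι → TimeMeasure T U}
    {q₀ : TimeMeasure T U} :
    Tendsto q l (𝓝 q₀) ↔ ∀ φ : TimeMeasure.StableTest T U,
      Tendsto (fun i => ∫ x, φ.toFun x ∂(q i).toMeasure) l (𝓝 (∫ x, φ.toFun x ∂q₀.toMeasure)) := by
  simp only [nhds_iInf, nhds_induced, tendsto_iInf, tendsto_comap_iff, Function.comp_def]

theorem TimeMeasure.tendsto_toFiniteMeasure {T : ℝ≥0} {U : Type*} [MeasurableSpace U]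
    [TopologicalSpace U] [OpensMeasurableSpace (Set.Icc (0 : ℝ) T × U)] {ι : Type*}
    {l : Filter ι} {q : ι → TimeMeasure T U} {q₀ : TimeMeasure T U} (h : Tendsto q l (𝓝 q₀)) :
    Tendsto (fun i => (q i).toFiniteMeasure) l (𝓝 q₀.toFiniteMeasure) := by
  rw [FiniteMeasure.tendsto_iff_forall_integral_tendsto]
  intro f
  exact TimeMeasure.tendsto_iff_forall_integral_tendsto.1 h
    { toFun := f
      measurable := f.continuous.measurable
      bounded := ⟨‖f‖, f.norm_coe_le_norm⟩
      continuous := fun t => f.continuous.comp (Continuous.prodMk_right t) }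

/-! ### Test functions as integrable maps from time to `C(U, ℝ)`. -/

section StableTest

variable {T : ℝ≥0} {U : Type*} [TopologicalSpace U] [MeasurableSpace U]

open Classical in
/-- A test function of stable convergence as a function of time with values in `C(U, ℝ)`,
extended by zero. -/
noncomputable def TimeMeasure.StableTest.toContinuousMap (φ : TimeMeasure.StableTest T U) (t : ℝ) :
    C(U, ℝ) :=
  if h : t ∈ Set.Icc (0 : ℝ) T then ⟨fun a => φ.toFun (⟨t, h⟩, a), φ.continuous ⟨t, h⟩⟩ else 0

theorem TimeMeasure.StableTest.toContinuousMap_coe (φ : TimeMeasure.StableTest T U)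
    (t : Set.Icc (0 : ℝ) T) (a : U) : φ.toContinuousMap t a = φ.toFun (t, a) := by
  simp [toContinuousMap]

theorem TimeMeasure.StableTest.toContinuousMap_of_notMem (φ : TimeMeasure.StableTest T U)
    {t : ℝ} (ht : t ∉ Set.Icc (0 : ℝ) T) : φ.toContinuousMap t = 0 :=
  dif_neg ht

theorem TimeMeasure.StableTest.stronglyMeasurable_toContinuousMap [CompactSpace U]
    [TopologicalSpace.MetrizableSpace U] (φ : TimeMeasure.StableTest T U) :
    StronglyMeasurable φ.toContinuousMap := by
  classical
  refine ContinuousMap.stronglyMeasurable_of_measurable_apply fun a => ?_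
  have h : (fun t => φ.toContinuousMap t a) = fun t =>
      if h : t ∈ Set.Icc (0 : ℝ) T then φ.toFun (⟨t, h⟩, a) else 0 := by
    funext t
    by_cases ht : t ∈ Set.Icc (0 : ℝ) T
    · rw [dif_pos ht, ← toContinuousMap_coe φ ⟨t, ht⟩ a]
    · rw [dif_neg ht, φ.toContinuousMap_of_notMem ht, ContinuousMap.zero_apply]
  rw [h]
  exact Measurable.dite (s := {t | t ∈ Set.Icc (0 : ℝ) T})
    (φ.measurable.comp measurable_prodMk_right) measurable_const measurableSet_Icc

theorem TimeMeasure.StableTest.integrable_toContinuousMap [CompactSpace U]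
    [TopologicalSpace.MetrizableSpace U] (φ : TimeMeasure.StableTest T U) :
    Integrable φ.toContinuousMap := by
  obtain ⟨C, hC⟩ := φ.bounded
  refine Integrable.mono' (g := (Set.Icc (0 : ℝ) T).indicator fun _ => |C|)
    ((integrable_indicator_iff measurableSet_Icc).2 (by simp))
    φ.stronglyMeasurable_toContinuousMap.aestronglyMeasurable (Eventually.of_forall fun t => ?_)
  by_cases ht : t ∈ Set.Icc (0 : ℝ) T
  · rw [Set.indicator_of_mem ht, ContinuousMap.norm_le _ (abs_nonneg C)]
    intro a
    rw [φ.toContinuousMap_coe ⟨t, ht⟩ a]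
    exact (hC _).trans (le_abs_self C)
  · rw [φ.toContinuousMap_of_notMem ht, Set.indicator_of_notMem ht, norm_zero]

/-- The extended test function vanishes off `[0,T]`, so the values of `κ'` there are irrelevant. -/
theorem TimeMeasure.StableTest.integral_compProd (φ : TimeMeasure.StableTest T U)
    (κ : Kernel (Set.Icc (0 : ℝ) T) U) [IsMarkovKernel κ] {κ' : Kernel ℝ U}
    (h : ∀ t : Set.Icc (0 : ℝ) T, κ' t = κ t) :
    ∫ x, φ.toFun x ∂(lebesgueIcc T ⊗ₘ κ) = ∫ t, ∫ a, φ.toContinuousMap t a ∂κ' t := by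
  obtain ⟨C, hC⟩ := φ.bounded
  have hi : Integrable φ.toFun (lebesgueIcc T ⊗ₘ κ) :=
    Integrable.of_bound φ.measurable.aestronglyMeasurable C (Eventually.of_forall hC)
  rw [Measure.integral_compProd hi, ← setIntegral_eq_integral_of_forall_compl_eq_zero
    (s := Set.Icc (0 : ℝ) T), ← integral_subtype_comap measurableSet_Icc]
  · refine integral_congr_ae (Eventually.of_forall fun t => ?_)
    simp only [h, φ.toContinuousMap_coe]
  · intro t ht
    simp only [φ.toContinuousMap_of_notMem ht, ContinuousMap.zero_apply, integral_zero]

end StableTest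

/-! ### Adapted chattering -/

section Control

variable {d : ℕ} {𝔓 : Set (ProbabilityMeasure (PathSpace d))} {T : ℝ≥0}
  {U : Type*} [MeasurableSpace U]

/-- The kernel of a relaxed control along a path, extended to a kernel on the whole time axis by its
values at `0` and `T`. -/
noncomputable def RelaxedControl.extendedKernel (μ : RelaxedControl 𝔓 T U) (ω : PathSpace d) :
    Kernel ℝ U :=
  (μ.kernel ω).comap (Set.projIcc (0 : ℝ) T T.2) continuous_projIcc.measurable

instance (μ : RelaxedControl 𝔓 T U) (ω : PathSpace d) : IsMarkovKernel (μ.extendedKernel ω) := by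
  unfold RelaxedControl.extendedKernel
  infer_instance

theorem RelaxedControl.extendedKernel_coe (μ : RelaxedControl 𝔓 T U) (ω : PathSpace d)
    (t : Set.Icc (0 : ℝ) T) : μ.extendedKernel ω t = μ.kernel ω t :=
  congrArg (μ.kernel ω) (Set.projIcc_val T.2 t)

theorem RelaxedControl.isProgressive_chatterIndex (μ : RelaxedControl 𝔓 T U) {ind : U → ℕ}
    (hind : Measurable ind) (n : ℕ) :
    IsProgressive (PathSpace.universalFiltration 𝔓 T) fun t ω =>
      chatterIndex (indexCdf (μ.extendedKernel ω) ind) n t := by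
  intro i
  let := PathSpace.universalFiltration 𝔓 T i
  have hle : ∀ s : ℝ, Set.projIcc (0 : ℝ) T T.2 (min s i) ≤ i := fun s =>
    (Set.monotone_projIcc T.2 (min_le_right s i)).trans_eq (Set.projIcc_val T.2 i)
  -- Time is stopped at `i`, so that only values of `μ` on `[0,i]` enter; these are jointly
  -- measurable with respect to the σ-algebra at `i`. Negative times use the value at `0`.
  have hm : ∀ j, Measurable fun p : ℝ × PathSpace d =>
      indexCdf (μ.extendedKernel p.2) ind (min p.1 i) j := by
    intro j
    have hj := μ.progressive {a | ind a ≤ j} (hind measurableSet_Iic) i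
    have hp : Measurable fun p : ℝ × PathSpace d =>
        ((⟨Set.projIcc (0 : ℝ) T T.2 (min p.1 i), hle p.1⟩ : Set.Iic i), p.2) :=
      ((continuous_projIcc.measurable.comp
        (measurable_fst.min measurable_const)).subtype_mk).prodMk measurable_snd
    exact (hj.comp hp).coe_nnreal_real
  have h := (measurable_chatterIndex (m := fun ω s j => indexCdf (μ.extendedKernel ω) ind (min s i) j)
    hm n).comp ((measurable_subtype_coe.comp (measurable_subtype_coe.comp measurable_fst)).prodMk
      measurable_snd : Measurable fun p : Set.Iic i × PathSpace d => ((p.1 : ℝ), p.2))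
  convert! h using 1
  funext p
  -- Stopping does not change the index at a time up to `i`, which depends only on earlier times.
  refine chatterIndex_congr n fun s hs => ?_
  have hsi : s ≤ i := hs.le.trans p.1.2
  simp only [min_eq_left hsi]

variable [MetricSpace U] [BorelSpace U]

/-- The strict control that imitates a relaxed control by chattering with mesh `1/(n+1)` between
the first points of a sequence. -/
noncomputable def RelaxedControl.chatterControl (μ : RelaxedControl 𝔓 T U) (e : ℕ → U) (n : ℕ) :
    StrictControl 𝔓 T U where
  toFun t ω := chatter e (μ.extendedKernel ω) n t
  progressive i := measurable_from_top.comp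
    (μ.isProgressive_chatterIndex (SimpleFunc.nearestPtInd e n).measurable n i)

theorem RelaxedControl.tendsto_randomMeasure_chatterControl [CompactSpace U]
    (μ : RelaxedControl 𝔓 T U) {e : ℕ → U} (he : DenseRange e) (ω : PathSpace d) :
    Tendsto (fun n => (μ.chatterControl e n).toRelaxed.randomMeasure ω) atTop
      (𝓝 (μ.randomMeasure ω)) := by
  rw [TimeMeasure.tendsto_iff_forall_integral_tendsto]
  intro φ
  have h := tendsto_integral_chatter (μ.extendedKernel ω) e he
    φ.stronglyMeasurable_toContinuousMap φ.integrable_toContinuousMap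
  have h1 : ∀ n, ∫ x, φ.toFun x ∂((μ.chatterControl e n).toRelaxed.randomMeasure ω).toMeasure =
      ∫ t, φ.toContinuousMap t (chatter e (μ.extendedKernel ω) n t) := by
    intro n
    have hc := measurable_chatter (μ.extendedKernel ω) e n
    -- Along a fixed path the strict control is a Dirac kernel, which `chatter` extends to the whole
    -- time axis.
    refine (φ.integral_compProd ((μ.chatterControl e n).toRelaxed.kernel ω)
      (κ' := Kernel.deterministic _ hc) fun t => ?_).trans ?_
    · rw [Kernel.deterministic_apply]
      rfl
    · simp only [Kernel.integral_deterministic]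
  have h2 : ∫ x, φ.toFun x ∂(μ.randomMeasure ω).toMeasure =
      ∫ t, ∫ a, φ.toContinuousMap t a ∂μ.extendedKernel ω t :=
    φ.integral_compProd (μ.kernel ω) (μ.extendedKernel_coe ω)
  simpa only [h1, h2] using h

end Control

/-! ### The chattering theorem. -/

theorem mainTheorem2 {d : ℕ} (𝔓 : Set (ProbabilityMeasure (PathSpace d))) (T : ℝ≥0)
    {U : Type*} [MetricSpace U] [CompactSpace U] [MeasurableSpace U] [BorelSpace U]
    (μ : RelaxedControl 𝔓 T U) :
    ∃ u : ℕ → StrictControl 𝔓 T U, PathSpace.QuasiSurely 𝔓 fun ω =>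
      Tendsto (fun n => (u n).toRelaxed.randomMeasure ω) atTop (𝓝 (μ.randomMeasure ω)) ∧
      Tendsto (fun n => ((u n).toRelaxed.randomMeasure ω).toFiniteMeasure) atTop
        (𝓝 (μ.randomMeasure ω).toFiniteMeasure) := by
  -- `U` carries a probability measure, namely `μ` at time `0` along the zero path, so it is
  -- nonempty and has a dense sequence.
  obtain ⟨a⟩ : Nonempty U := (μ.toFun ⟨0, le_rfl, T.2⟩ ⟨0, rfl⟩).nonempty
  have : Nonempty U := ⟨a⟩
  refine ⟨μ.chatterControl (TopologicalSpace.denseSeq U), ∅, ⟨MeasurableSet.empty, by simp⟩,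
    fun ω _ => ?_⟩
  have h := μ.tendsto_randomMeasure_chatterControl (TopologicalSpace.denseRange_denseSeq U) ω
  exact ⟨h, TimeMeasure.tendsto_toFiniteMeasure h⟩
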